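/- Let $\mathcal{X}\subset\mathbb{R}$ be a bounded interval with the Euclidean distance $d$, let $f:\mathcal{X}\to\mathcal{X}$ be measurable, and let $\mu$ be an $f$-invariant ergodic probability measure on $\mathcal{X}$ that is absolutely continuous with density $\rho\ge 0$ with respect to Lebesgue measure. For $\varphi:\mathcal{X}\to\mathbb{R}$ put $\|\varphi\|_{\mathrm{BV}}=\mathrm{var}(\varphi)+\sup|\varphi|$, and let $\mathrm{BV}$ be the set of $\varphi$ with $\|\varphi\|_{\mathrm{BV}}<\infty$. Assume that $(\mathcal{X},f,\mu)$ is hyperbolic recurrent, that is, $\rho\in\mathrm{BV}$ and: (A1) (exponential decay of correlations of $\mathrm{BV}$ versus $L^1(\mu)$) there are $C,\alpha>0$ such that for all $\varphi_1\in \mathrm{BV}$, $\varphi_2\in L^1(\mu)$ and $j\ge 0$, $$\Bigl|\int\varphi_1\cdot\varphi_2\circ f^j\,d\mu-\int\varphi_1\,d\mu\int\varphi_2\,d\mu\Bigr|\le Ce^{-\alpha j}\,\|\varphi_1\|_{\mathrm{BV}}\int|\varphi_2|\,d\mu ;$$ (A2) for every $a>0$ and every sequence $(s_n)$ for which there is $c>1$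 with $s_n/n^{-a}\in[c^{-1},c]$ for all large $n$, there are $\beta_0\in(0,1)$ and $C>0$ such that for all large $n$ and all integers $1\le j\le(\log n)^2$, $$\mu\{x\in\mathcal{X}: d(x,f^jx)\le s_n\}\le C s_n^{\beta_0}.$$ Suppose that $\rho$ is piecewise Hölder with finitely many jumps: the set $\mathcal{C}$ of discontinuity points of $\rho$ in $\mathcal{X}$ is finite, and there are $\eta\in(0,1]$, $L>0$ and $\delta>0$ such that $|\rho(x)-\rho(y)|\le L|x-y|^\eta$ for all $x,y\in\mathcal{X}$ with $|x-y|<\delta$ for which the closed interval between $x$ and $y$ contains no point of $\mathcal{C}$. (In particular $\rho$ has left and right limits at the points of $\mathcal{C}$.) Let $\gamma_0\in\mathbb{R}$ be such that $$\sum_{k\ge 1}\int_{\mathcal{X}}\rho(x)e^{-\epsilon k^{\gamma_0}\rho(x)}\,dx<\infty\qquad\text{for all }\epsilon>0,$$ let $\gamma>\gamma_0$, and let $(r_n)$ be a real sequence with $r_n>\frac{(\log n)^{\gamma}}{2n}$ for all sufficiently large $n$. Then $$\mu\Bigl\{x\in\mathcal{X}:\ \min_{1\le k\le n}d(f^kx,x)<r_n\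 \text{ for all sufficiently large } n\Bigr\}=1.$$ -/

import Mathlib

open MeasureTheory Filter Topology Set
open scoped ENNReal

/-- The phase space is a subset `X` of the line with its ambient metric, its order and Lebesgue
measure, so all notions below are for functions and maps on the type `X`.
`bvNorm φ = var(φ) + sup |φ|`, with values in `[0, ∞]`. -/
noncomputable def bvNorm {X : Set ℝ} (φ : X → ℝ) : ℝ≥0∞ :=
  eVariationOn φ univ + ⨆ x, ‖φ x‖ₑ

/-- Functions of bounded variation: `‖φ‖_BV < ∞`. -/
def IsBV {X : Set ℝ} (φ : X → ℝ) : Prop := bvNorm φ < ∞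

/-- Decay of correlations in `BV` versus `L¹(μ)` with rate function `Θ(j) → 0`. -/
def HasDecayBVL1 {X : Set ℝ} (f : X → X) (μ : Measure X) (Θ : ℕ → ℝ) : Prop :=
  Tendsto Θ atTop (𝓝 0) ∧
  ∀ φ₁ φ₂ : X → ℝ, IsBV φ₁ → Integrable φ₂ μ → ∀ j : ℕ,
    |∫ x, φ₁ x * φ₂ (f^[j] x) ∂μ - (∫ x, φ₁ x ∂μ) * ∫ x, φ₂ x ∂μ|
      ≤ Θ j * (bvNorm φ₁).toReal * ∫ x, |φ₂ x| ∂μ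

/-- Exponential decay of correlations in `BV` versus `L¹(μ)`. -/
def HasExpDecayBVL1 {X : Set ℝ} (f : X → X) (μ : Measure X) : Prop :=
  ∃ C α : ℝ, 0 < C ∧ 0 < α ∧ HasDecayBVL1 f μ (fun j => C * Real.exp (-α * j))

/-- The set `E_j(r)` of points that return to within distance `r` of themselves at time `j`. -/
def returnSet {X : Set ℝ} (f : X → X) (j : ℕ) (r : ℝ) : Set X :=
  {x | dist x (f^[j] x) ≤ r}

/-- `a_n ≈ b_n`: the ratio stays in `[c⁻¹, c]` for all large `n`. -/
def Comparable (a b : ℕ → ℝ) : Prop :=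
  ∃ c : ℝ, 1 < c ∧ ∀ᶠ n in atTop, a n / b n ∈ Icc c⁻¹ c

/-- Short returns are rare: if `r_n ≈ n^{-a}` for some `a > 0`, then `μ(E_j(r_n)) ≤ C r_n^{β₀}` for
all `1 ≤ j ≤ (log n)²`, with `β₀ ∈ (0, 1)` and `C` independent of `j` and `n`. -/
def HasRareShortReturns {X : Set ℝ} (f : X → X) (μ : Measure X) : Prop :=
  ∀ (a : ℝ) (r : ℕ → ℝ), 0 < a → Comparable r (fun n => (n : ℝ) ^ (-a)) →
    ∃ β₀ C : ℝ, 0 < β₀ ∧ β₀ < 1 ∧ 0 < C ∧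
      ∀ᶠ n : ℕ in atTop, ∀ j : ℕ, 1 ≤ j → (j : ℝ) ≤ Real.log n ^ 2 →
        μ.real (returnSet f j (r n)) ≤ C * r n ^ β₀

/-- Lebesgue measure on `X`. -/
noncomputable def lebesgueOn (X : Set ℝ) : Measure X := Measure.comap Subtype.val volume

/-- A hyperbolic recurrent system `(X, f, μ)` with invariant density `ρ ∈ BV`. `Ergodic` contains
the measurability of `f` and the invariance of `μ`. -/
structure IsHyperbolicRecurrent {X : Set ℝ} (f : X → X) (μ : Measure X) (ρ : X → ℝ) : Prop where
  ergodic : Ergodic f μ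
  density_nonneg : ∀ x, 0 ≤ ρ x
  density_eq : μ = (lebesgueOn X).withDensity (fun x => ENNReal.ofReal (ρ x))
  density_bv : IsBV ρ
  exp_decay : HasExpDecayBVL1 f μ
  rare_short_returns : HasRareShortReturns f μ

/-- The points of `X` at which `ρ` is discontinuous (relative to `X`). -/
def discontinuities {X : Set ℝ} (ρ : X → ℝ) : Set X := {x | ¬ ContinuousAt ρ x}

/-- `ρ` has finitely many discontinuities and is uniformly Hölder on every piece of `X` between
consecutive ones, with the same exponent and constants on all pieces. At the discontinuities the
one-sided limits exist because of the Hölder bound, and the value of `ρ` there is not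
constrained. -/
def IsPiecewiseHolder {X : Set ℝ} (ρ : X → ℝ) : Prop :=
  (discontinuities ρ).Finite ∧
  ∃ η L δ : ℝ, 0 < η ∧ η ≤ 1 ∧ 0 < L ∧ 0 < δ ∧
    ∀ x y : X, dist x y < δ → Disjoint (uIcc x y) (discontinuities ρ) →
      |ρ x - ρ y| ≤ L * dist x y ^ η

/-- `min_{1 ≤ k ≤ n} d(f^k x, x)`, for `n ≥ 1`. -/
noncomputable def minReturnDist {X : Set ℝ} (f : X → X) (n : ℕ) (x : X) : ℝ :=
  sInf ((fun k : ℕ => dist (f^[k] x) x) '' Icc 1 n)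


/-! A point of a grid cell `A` of mesh `s` that does not return `s`-close to itself up to time `N`
does not come back to `A` either. Write `D n` for the set of points avoiding `A` at the times
`0, …, n - 1`. Decay of correlations against `L¹(μ)` makes `A` nearly independent of the preimage
of `D n` under a high iterate `f^[g]`, with an error proportional to `μ (D n)`, and skipping the
first `g` steps only costs the mass of the short returns of `A`. Hence
`μ (D (n + 1)) ≤ exp (e - μ A) * μ (D n) + (short returns)`, and `μ (D n)` is at most of
order `exp (-n μ A)`.

Away from the jumps of `ρ`, Hölder continuity replaces `μ A` by `s ρ` in the exponent, so the sum
over the cells of `μ A exp (-n μ A)` is at most of order `∫ ρ exp (-n s ρ)`. At the times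
`n = 2 ^ k`, with `n s = c k ^ γ` and `g` of order `k`, this integral is a term of the series in
the hypothesis, while the short returns, the correlation errors and the cells near the jumps are
summable. Borel–Cantelli along the dyadic times and monotonicity in between conclude. -/

section Avoidance

variable {α : Type*}

/-- The points whose orbit avoids `A` at the times `0, …, n - 1`. -/
def avoidSet (f : α → α) (A : Set α) (n : ℕ) : Set α := {x | ∀ j < n, f^[j] x ∉ A}

theorem avoidSet_succ (f : α → α) (A : Set α) (n : ℕ) :
    avoidSet f A (n + 1) = f ⁻¹' avoidSet f A n \ A := by
  ext x
  simp only [avoidSet, mem_ofPred_eq, Set.mem_sdiff, mem_preimage]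
  refine ⟨fun h => ⟨fun j hj => h (j + 1) (by omega), h 0 (by omega)⟩, ?_⟩
  rintro ⟨h, hx⟩ (_ | j) hj
  · exact hx
  · exact h j (by omega)

theorem preimage_avoidSet_add_subset (f : α → α) (A : Set α) (g n : ℕ) :
    f ⁻¹' avoidSet f A (g + n) ⊆ f^[g + 1] ⁻¹' avoidSet f A n := by
  intro x hx j hj
  have h := hx (g + j) (by omega)
  rwa [← Function.iterate_succ_apply, show (g + j).succ = j + (g + 1) by omega,
    Function.iterate_add_apply] at h

theorem inter_iterate_preimage_avoidSet_subset (f : α → α) (A : Set α) (g n : ℕ) :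
    A ∩ f^[g + 1] ⁻¹' avoidSet f A n ⊆
      (A ∩ f ⁻¹' avoidSet f A n) ∪ ⋃ j ∈ Finset.Icc 1 g, A ∩ f^[j] ⁻¹' A := by
  rintro x ⟨hx, h⟩
  by_cases hs : ∃ j ∈ Finset.Icc 1 g, f^[j] x ∈ A
  · obtain ⟨j, hj, hj'⟩ := hs
    exact Or.inr (mem_biUnion hj ⟨hx, hj'⟩)
  · refine Or.inl ⟨hx, fun j hj hj' => ?_⟩
    rw [← Function.iterate_succ_apply] at hj'
    by_cases hjg : j + 1 ≤ g
    · exact hs ⟨j + 1, Finset.mem_Icc.2 ⟨by omega, hjg⟩, hj'⟩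
    · refine h (j - g) (by omega) ?_
      rwa [← Function.iterate_add_apply, show j - g + (g + 1) = j.succ by omega]

variable [MeasurableSpace α]

theorem measurableSet_avoidSet {f : α → α} {A : Set α} (hf : Measurable f) (hA : MeasurableSet A) :
    ∀ n, MeasurableSet (avoidSet f A n)
  | 0 => by simp [avoidSet]
  | n + 1 => avoidSet_succ f A n ▸ (hf (measurableSet_avoidSet hf hA n)).diff hA

/-- Quantitative independence of `A` from the events at time `j`. The error is proportional to
`μ(D)`, as decay of correlations against `L¹(μ)` provides it; this is what makes the bound
iterable along the sets `avoidSet f A n`. -/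
def CorrelationBound (f : α → α) (μ : Measure α) (A : Set α) (j : ℕ) (e : ℝ) : Prop :=
  ∀ D, MeasurableSet D → |μ.real (A ∩ f^[j] ⁻¹' D) - μ.real A * μ.real D| ≤ e * μ.real D

/-- The total measure of the returns of `A` to itself at the times `1, …, g`. -/
noncomputable def shortReturnMass (f : α → α) (μ : Measure α) (A : Set α) (g : ℕ) : ℝ :=
  ∑ j ∈ Finset.Icc 1 g, μ.real (A ∩ f^[j] ⁻¹' A)

variable {f : α → α} {μ : Measure α} {A B : Set α} {e e' : ℝ} {g j n : ℕ}

theorem shortReturnMass_nonneg : 0 ≤ shortReturnMass f μ A g :=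
  Finset.sum_nonneg fun _ _ => measureReal_nonneg

theorem CorrelationBound.mono (h : CorrelationBound f μ A j e) (hee' : e ≤ e') :
    CorrelationBound f μ A j e' :=
  fun D hD => (h D hD).trans (mul_le_mul_of_nonneg_right hee' measureReal_nonneg)

theorem CorrelationBound.nonneg [IsProbabilityMeasure μ] (h : CorrelationBound f μ A j e) :
    0 ≤ e := by
  simpa using h univ MeasurableSet.univ

theorem CorrelationBound.sdiff [IsFiniteMeasure μ] (hA : CorrelationBound f μ A j e)
    (hB : CorrelationBound f μ B j e') (hf : Measurable f) (hBm : MeasurableSet B) (hBA : B ⊆ A) :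
    CorrelationBound f μ (A \ B) j (e + e') := by
  intro D hD
  have hinter : (A \ B) ∩ f^[j] ⁻¹' D = (A ∩ f^[j] ⁻¹' D) \ (B ∩ f^[j] ⁻¹' D) := by
    ext x
    simp only [mem_inter_iff, Set.mem_sdiff]
    tauto
  rw [hinter, measureReal_sdiff (inter_subset_inter_left _ hBA) (hBm.inter ((hf.iterate j) hD)),
    measureReal_sdiff hBA hBm]
  have hA := abs_le.1 (hA D hD)
  have hB := abs_le.1 (hB D hD)
  rw [abs_le]
  constructor <;> linarith

theorem measureReal_inter_iterate_preimage_avoidSet_le [IsFiniteMeasure μ] (n : ℕ) :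
    μ.real (A ∩ f^[g + 1] ⁻¹' avoidSet f A n)
      ≤ μ.real (A ∩ f ⁻¹' avoidSet f A n) + shortReturnMass f μ A g :=
  calc _ ≤ _ := measureReal_mono (inter_iterate_preimage_avoidSet_subset f A g n)
    _ ≤ _ := measureReal_union_le _ _
    _ ≤ _ := add_le_add_right (measureReal_biUnion_finset_le _ _) _

theorem measureReal_avoidSet_succ_le [IsFiniteMeasure μ] (hf : MeasurePreserving f μ μ)
    (hA : MeasurableSet A) (hcor : CorrelationBound f μ A (g + 1) e) (n : ℕ) :
    μ.real (avoidSet f A (n + 1))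
      ≤ Real.exp (e - μ.real A) * μ.real (avoidSet f A n) + shortReturnMass f μ A g := by
  have hD := measurableSet_avoidSet hf.measurable hA n
  have hsplit : μ.real (avoidSet f A (n + 1)) + μ.real (A ∩ f ⁻¹' avoidSet f A n)
      = μ.real (avoidSet f A n) := by
    rw [avoidSet_succ, inter_comm, measureReal_sdiff_add_inter hA,
      hf.measureReal_preimage hD.nullMeasurableSet]
  have hdelay := measureReal_inter_iterate_preimage_avoidSet_le (μ := μ) (f := f) (A := A)
    (g := g) n
  have hindep := (abs_le.1 (hcor _ hD)).1
  have hexp := mul_le_mul_of_nonneg_right (Real.add_one_le_exp (e - μ.real A))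
    (measureReal_nonneg (μ := μ) (s := avoidSet f A n))
  linarith

theorem measureReal_avoidSet_le [IsProbabilityMeasure μ] (hf : MeasurePreserving f μ μ)
    (hA : MeasurableSet A) (hcor : CorrelationBound f μ A (g + 1) e) (hne : n * e ≤ 1) :
    μ.real (avoidSet f A n)
      ≤ Real.exp 1 * (Real.exp (-(n * μ.real A)) + n * shortReturnMass f μ A g) := by
  set Q := shortReturnMass f μ A g
  set q := Real.exp (e - μ.real A)
  have hQ : 0 ≤ Q := shortReturnMass_nonneg
  have hqn : q ^ n ≤ Real.exp 1 * Real.exp (-(n * μ.real A)) := by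
    rw [← Real.exp_nat_mul, ← Real.exp_add]
    gcongr
    linarith
  have hqm : ∀ m ≤ n, q ^ m ≤ Real.exp 1 := fun m hm => by
    have hme : m * e ≤ n * e := mul_le_mul_of_nonneg_right (by exact_mod_cast hm) hcor.nonneg
    have : 0 ≤ m * μ.real A := by positivity
    rw [← Real.exp_nat_mul]
    gcongr
    linarith
  calc μ.real (avoidSet f A n)
      ≤ μ.real (avoidSet f A 0) * ∏ _i ∈ Finset.Ico 0 n, q
        + ∑ k ∈ Finset.Ico 0 n, Q * ∏ _i ∈ Finset.Ico (k + 1) n, q :=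
        discrete_gronwall_prod_general (u := fun m => μ.real (avoidSet f A m)) (b := fun _ => Q)
          (c := fun _ => q) (fun m _ => measureReal_avoidSet_succ_le hf hA hcor m)
          (fun _ _ => (Real.exp_pos _).le) n.zero_le
    _ ≤ 1 * q ^ n + ∑ _k ∈ Finset.Ico 0 n, Q * Real.exp 1 := by
        simp only [Finset.prod_const, Nat.card_Ico, Nat.sub_zero]
        gcongr with k
        · exact measureReal_le_one
        · exact hqm _ (Nat.sub_le _ _)
    _ = q ^ n + Real.exp 1 * (n * Q) := by
        simp only [Finset.sum_const, Nat.card_Ico, Nat.sub_zero, nsmul_eq_mul]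
        ring
    _ ≤ Real.exp 1 * (Real.exp (-(n * μ.real A)) + n * Q) := by linarith

theorem measureReal_inter_preimage_avoidSet_le [IsProbabilityMeasure μ]
    (hf : MeasurePreserving f μ μ) (hA : MeasurableSet A)
    (hcor : CorrelationBound f μ A (g + 1) e) (hne : n * e ≤ 1) :
    μ.real (A ∩ f ⁻¹' avoidSet f A (g + n))
      ≤ Real.exp 1 * (μ.real A * Real.exp (-(n * μ.real A))
        + μ.real A * n * shortReturnMass f μ A g) + e := by
  set D := avoidSet f A n
  calc μ.real (A ∩ f ⁻¹' avoidSet f A (g + n))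
      ≤ μ.real (A ∩ f^[g + 1] ⁻¹' D) :=
        measureReal_mono (inter_subset_inter_right A (preimage_avoidSet_add_subset f A g n))
    _ ≤ μ.real A * μ.real D + e * μ.real D := by
        linarith [(abs_le.1 (hcor D (measurableSet_avoidSet hf.measurable hA n))).2]
    _ ≤ μ.real A * (Real.exp 1 * (Real.exp (-(n * μ.real A)) + n * shortReturnMass f μ A g))
        + e * 1 := by
        gcongr
        · exact measureReal_avoidSet_le hf hA hcor hne
        · exact hcor.nonneg
        · exact measureReal_le_one
    _ = _ := by ring

end Avoidance

section Density

variable {α : Type*} [MeasurableSpace α] {ν : Measure α} {ρ : α → ℝ} {A : Set α}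

theorem measureReal_withDensity_ofReal (hρ : AEStronglyMeasurable ρ ν) (hρ0 : ∀ x, 0 ≤ ρ x)
    (hA : MeasurableSet A) :
    (ν.withDensity fun x => ENNReal.ofReal (ρ x)).real A = ∫ x in A, ρ x ∂ν := by
  rw [integral_eq_lintegral_of_nonneg_ae (Eventually.of_forall hρ0) hρ.restrict,
    measureReal_def, withDensity_apply _ hA]

theorem measureReal_withDensity_ofReal_le [IsFiniteMeasure ν] {M : NNReal} (hM : ∀ x, ρ x ≤ M)
    (hA : MeasurableSet A) :
    (ν.withDensity fun x => ENNReal.ofReal (ρ x)).real A ≤ M * ν.real A := by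
  have hle : ∫⁻ x in A, ENNReal.ofReal (ρ x) ∂ν ≤ M * ν A := by
    rw [← setLIntegral_const]
    exact lintegral_mono fun x => ENNReal.ofReal_le_iff_le_toReal (by simp) |>.2 (hM x)
  rw [measureReal_def, withDensity_apply _ hA]
  simpa [measureReal_def] using ENNReal.toReal_mono (by finiteness) hle

theorem integrable_mul_exp_neg_mul (hρ : Integrable ρ ν) (hρ0 : ∀ x, 0 ≤ ρ x) {a : ℝ}
    (ha : 0 ≤ a) : Integrable (fun x => ρ x * Real.exp (-(a * ρ x))) ν := by
  refine hρ.mono' (hρ.aestronglyMeasurable.mul (Real.continuous_exp.comp_aestronglyMeasurable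
    (hρ.aestronglyMeasurable.const_mul a).neg)) (Eventually.of_forall fun x => ?_)
  have hx := hρ0 x
  rw [Real.norm_of_nonneg (by positivity)]
  exact mul_le_of_le_one_right hx (Real.exp_le_one_iff.2 (neg_nonpos.2 (by positivity)))

theorem integral_mul_exp_neg_mul_anti (hρ : Integrable ρ ν) (hρ0 : ∀ x, 0 ≤ ρ x)
    {a b : ℝ} (ha : 0 ≤ a) (hab : a ≤ b) :
    ∫ x, ρ x * Real.exp (-(b * ρ x)) ∂ν ≤ ∫ x, ρ x * Real.exp (-(a * ρ x)) ∂ν := by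
  refine integral_mono (integrable_mul_exp_neg_mul hρ hρ0 (ha.trans hab))
    (integrable_mul_exp_neg_mul hρ hρ0 ha) fun x => ?_
  have := hρ0 x
  dsimp only
  gcongr

theorem summable_integral_mul_exp_neg_rpow_mono (hρ : Integrable ρ ν)
    (hρ0 : ∀ x, 0 ≤ ρ x) {ε γ₀ γ : ℝ} (hε : 0 ≤ ε) (hγ : γ₀ ≤ γ)
    (hsum : Summable fun k : ℕ =>
      ∫ x, ρ x * Real.exp (-(ε * ((k + 1 : ℕ) : ℝ) ^ γ₀ * ρ x)) ∂ν) :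
    Summable fun k : ℕ => ∫ x, ρ x * Real.exp (-(ε * ((k + 1 : ℕ) : ℝ) ^ γ * ρ x)) ∂ν := by
  refine hsum.of_nonneg_of_le
    (fun k => integral_nonneg fun x => mul_nonneg (hρ0 x) (Real.exp_pos _).le)
    fun k => integral_mul_exp_neg_mul_anti hρ hρ0 (by positivity) ?_
  gcongr
  exact_mod_cast k.succ_pos

theorem measureReal_mul_sub_le_setIntegral [IsFiniteMeasure ν] (hρ : Integrable ρ ν)
    (hA : MeasurableSet A) {κ : ℝ} (hosc : ∀ x ∈ A, ∀ y ∈ A, ρ x - ρ y ≤ κ) {x : α} (hx : x ∈ A) :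
    ν.real A * (ρ x - κ) ≤ ∫ y in A, ρ y ∂ν := by
  rw [← smul_eq_mul, ← setIntegral_const]
  exact setIntegral_mono_on (integrable_const _) hρ.integrableOn hA
    fun y hy => by linarith [hosc x hx y hy]

theorem setIntegral_mul_exp_neg_le [IsFiniteMeasure ν] (hρ : Integrable ρ ν)
    (hρ0 : ∀ x, 0 ≤ ρ x) (hA : MeasurableSet A) {κ a : ℝ}
    (hosc : ∀ x ∈ A, ∀ y ∈ A, ρ x - ρ y ≤ κ) (ha : 0 ≤ a) (hκ : a * ν.real A * κ ≤ 1) :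
    (∫ x in A, ρ x ∂ν) * Real.exp (-(a * ∫ x in A, ρ x ∂ν))
      ≤ Real.exp 1 * ∫ x in A, ρ x * Real.exp (-(a * ν.real A * ρ x)) ∂ν := by
  set m := ∫ x in A, ρ x ∂ν
  have hexp : ∀ x ∈ A, Real.exp (-(a * m)) ≤ Real.exp 1 * Real.exp (-(a * ν.real A * ρ x)) := by
    intro x hx
    have hlow := mul_le_mul_of_nonneg_left (measureReal_mul_sub_le_setIntegral hρ hA hosc hx) ha
    rw [← Real.exp_add]
    gcongr
    linarith
  rw [← integral_mul_const (Real.exp (-(a * m))), ← integral_const_mul (Real.exp 1)]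
  refine setIntegral_mono_on (hρ.mul_const _).integrableOn
    ((integrable_mul_exp_neg_mul hρ hρ0 (by positivity)).const_mul _).integrableOn hA
    fun x hx => ?_
  rw [mul_left_comm]
  exact mul_le_mul_of_nonneg_left (hexp x hx) (hρ0 x)

end Density

section BoundedVariation

variable {X : Set ℝ}

theorem bvNorm_le_of_monotone {h : X → ℝ} {c : ℝ} (hm : Monotone h) (h0 : ∀ x, 0 ≤ h x)
    (hc : ∀ x, h x ≤ c) : bvNorm h ≤ 2 * ENNReal.ofReal c := by
  have hvar : eVariationOn h univ ≤ ENNReal.ofReal c := by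
    rw [eVariationOn.eq_biSup_inter_Icc]
    refine iSup₂_le fun p _ => ?_
    rw [(hm.monotoneOn univ).eVariationOn_eq (mem_univ _) (mem_univ _)]
    exact ENNReal.ofReal_le_ofReal (by linarith [h0 p.1, hc p.2])
  have hsup : ⨆ x, ‖h x‖ₑ ≤ ENNReal.ofReal c := iSup_le fun x => by
    rw [Real.enorm_of_nonneg (h0 x)]
    exact ENNReal.ofReal_le_ofReal (hc x)
  exact (add_le_add hvar hsup).trans_eq (two_mul _).symm

theorem IsBV.measurable {φ : X → ℝ} (h : IsBV φ) : Measurable φ := by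
  have hvar : BoundedVariationOn φ univ := (lt_of_le_of_lt le_self_add h).ne
  obtain ⟨p, q, hp, hq, rfl⟩ := hvar.locallyBoundedVariationOn.exists_monotoneOn_sub_monotoneOn
  exact (monotoneOn_univ.1 hp).measurable.sub (monotoneOn_univ.1 hq).measurable

theorem IsBV.exists_norm_le {φ : X → ℝ} (h : IsBV φ) : ∃ M : NNReal, ∀ x, ‖φ x‖ ≤ M := by
  have hsup : ⨆ x, ‖φ x‖ₑ < ∞ := lt_of_le_of_lt le_add_self h
  refine ⟨(⨆ x, ‖φ x‖ₑ).toNNReal, fun x => ?_⟩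
  rw [← toReal_enorm]
  exact ENNReal.toReal_mono hsup.ne (le_iSup (fun x => ‖φ x‖ₑ) x)

theorem IsBV.integrable {ν : Measure X} [IsFiniteMeasure ν] {φ : X → ℝ}
    (h : IsBV φ) : Integrable φ ν := by
  obtain ⟨M, hM⟩ := h.exists_norm_le
  exact Integrable.of_bound h.measurable.aestronglyMeasurable M (Eventually.of_forall hM)

variable {f : X → X} {μ : Measure X} [IsFiniteMeasure μ] {Θ : ℕ → ℝ} {A : Set X}

theorem HasDecayBVL1.correlationBound_of_isUpperSet (h : HasDecayBVL1 f μ Θ) (hf : Measurable f)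
    {j : ℕ} (hΘ : 0 ≤ Θ j) (hA : IsUpperSet A) : CorrelationBound f μ A j (2 * Θ j) := by
  intro D hD
  have hAm : MeasurableSet A := hA.ordConnected.measurableSet
  have hmono : Monotone (A.indicator (1 : X → ℝ)) := fun x y hxy => by
    by_cases hx : x ∈ A
    · simp [hx, hA hxy hx]
    · rw [indicator_of_notMem hx]
      exact indicator_nonneg (fun _ _ => zero_le_one) y
  have hbv : bvNorm (A.indicator (1 : X → ℝ)) ≤ 2 := by
    simpa using bvNorm_le_of_monotone (c := 1) hmono (indicator_nonneg fun _ _ => zero_le_one)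
      (indicator_le_self' fun _ _ => zero_le_one)
  have hcor := h.2 (A.indicator 1) (D.indicator 1) (hbv.trans_lt (by simp))
    ((integrable_const (1 : ℝ)).indicator hD) j
  have hprod : ∀ x, A.indicator (1 : X → ℝ) x * D.indicator (1 : X → ℝ) (f^[j] x)
      = (A ∩ f^[j] ⁻¹' D).indicator 1 x := fun x => by
    rw [inter_indicator_one]
    rfl
  have habs : ∀ x, |D.indicator (1 : X → ℝ) x| = D.indicator 1 x := fun x =>
    abs_of_nonneg (indicator_nonneg (fun _ _ => zero_le_one) x)
  simp only [hprod, habs] at hcor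
  rw [integral_indicator_one (hAm.inter ((hf.iterate j) hD)), integral_indicator_one hAm,
    integral_indicator_one hD] at hcor
  refine hcor.trans (mul_le_mul_of_nonneg_right ?_ measureReal_nonneg)
  rw [mul_comm 2]
  gcongr
  exact ENNReal.toReal_le_of_le_ofReal zero_le_two (by simpa using hbv)

theorem HasDecayBVL1.correlationBound_of_ordConnected (h : HasDecayBVL1 f μ Θ)
    (hf : Measurable f) {j : ℕ} (hΘ : 0 ≤ Θ j) (hA : A.OrdConnected) :
    CorrelationBound f μ A j (4 * Θ j) := by
  set U : Set X := ↑(upperClosure A)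
  have hU : IsUpperSet U := (upperClosure A).upper
  have hUA : IsUpperSet (U \ A) := by
    rintro x y hxy ⟨hx, hxA⟩
    refine ⟨hU hxy hx, fun hyA => hxA ?_⟩
    obtain ⟨a, ha, hax⟩ := mem_upperClosure.1 hx
    exact hA.out ha hyA ⟨hax, hxy⟩
  rw [← sdiff_sdiff_cancel_left (subset_upperClosure (s := A))]
  refine ((h.correlationBound_of_isUpperSet hf hΘ hU).sdiff
    (h.correlationBound_of_isUpperSet hf hΘ hUA) hf hUA.ordConnected.measurableSet
    sdiff_subset).mono ?_
  linarith

theorem exists_nat_forall_exp_neg_mul_le_pow {a q : ℝ} (ha : 0 < a) (hq : 0 < q) :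
    ∃ K : ℕ, ∀ k : ℕ, Real.exp (-a * (K * k + 1 : ℕ)) ≤ q ^ k := by
  obtain ⟨K, hK⟩ := exists_nat_ge (-Real.log q / a)
  rw [div_le_iff₀ ha] at hK
  refine ⟨K, fun k => ?_⟩
  rw [← Real.exp_log hq, ← Real.exp_nat_mul]
  refine Real.exp_le_exp.2 ?_
  push_cast
  nlinarith [mul_le_mul_of_nonneg_left hK k.cast_nonneg]

theorem HasExpDecayBVL1.exists_correlationBound (h : HasExpDecayBVL1 f μ) (hf : Measurable f)
    {q : ℝ} (hq : 0 < q) : ∃ (K : ℕ) (C : ℝ), ∀ (k : ℕ) (A : Set X), A.OrdConnected →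
      CorrelationBound f μ A (K * k + 1) (C * q ^ k) := by
  obtain ⟨C, a, hC, ha, hdecay⟩ := h
  obtain ⟨K, hK⟩ := exists_nat_forall_exp_neg_mul_le_pow ha hq
  refine ⟨K, 4 * C, fun k A hA =>
    (hdecay.correlationBound_of_ordConnected hf (by positivity) hA).mono ?_⟩
  rw [mul_assoc]
  gcongr
  exact hK k

end BoundedVariation

section Grid

variable {X : Set ℝ} {ρ : X → ℝ} {s : ℝ} {i : ℤ} {x y : X}

theorem lebesgueOn_real_preimage (hX : MeasurableSet X) (B : Set ℝ) :
    (lebesgueOn X).real (Subtype.val ⁻¹' B) = volume.real (X ∩ B) := by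
  rw [lebesgueOn, measureReal_def, comap_subtype_coe_apply hX, Subtype.image_preimage_coe,
    measureReal_def]

theorem isFiniteMeasure_lebesgueOn (hX : MeasurableSet X) (hXb : Bornology.IsBounded X) :
    IsFiniteMeasure (lebesgueOn X) := by
  refine ⟨?_⟩
  rw [lebesgueOn, comap_subtype_coe_apply hX, image_univ, Subtype.range_coe]
  exact hXb.measure_lt_top

/-- The part of `X` in the `i`-th cell of the grid of mesh `s` on the line. -/
def gridCell (X : Set ℝ) (s : ℝ) (i : ℤ) : Set X := Subtype.val ⁻¹' Ico (i • s) ((i + 1) • s)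

theorem ordConnected_gridCell : (gridCell X s i).OrdConnected :=
  ordConnected_Ico.preimage_mono fun _ _ h => h

theorem measurableSet_gridCell : MeasurableSet (gridCell X s i) :=
  ordConnected_gridCell.measurableSet

theorem pairwise_disjoint_gridCell (X : Set ℝ) (s : ℝ) :
    Pairwise (Function.onFun Disjoint (gridCell X s)) := fun _ _ hij =>
  (pairwise_disjoint_Ico_zsmul s hij).preimage _

theorem abs_sub_lt_of_mem_Ico_zsmul {a b : ℝ} (ha : a ∈ Ico (i • s) ((i + 1) • s))
    (hb : b ∈ Ico (i • s) ((i + 1) • s)) : |a - b| < s := by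
  rw [add_smul, one_smul] at ha hb
  rw [abs_lt]
  constructor <;> linarith [ha.1, ha.2, hb.1, hb.2]

theorem dist_lt_of_mem_gridCell (hx : x ∈ gridCell X s i) (hy : y ∈ gridCell X s i) :
    dist x y < s :=
  abs_sub_lt_of_mem_Ico_zsmul hx hy

/-- The points of the line near which a grid cell may fail to be a full interval contained in `X`
on which `ρ` is continuous. The end points `sInf X` and `sSup X` have this meaning for
bounded `X`. -/
def breakPoints (ρ : X → ℝ) : Set ℝ :=
  insert (sInf X) (insert (sSup X) (Subtype.val '' discontinuities ρ))

/-- The indices of the grid cells of mesh `s` that lie inside `X` and contain no discontinuity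
of `ρ`. -/
def regularCells (ρ : X → ℝ) (s : ℝ) : Set ℤ :=
  {i | Ico (i • s) ((i + 1) • s) ⊆ X ∧ Disjoint (gridCell X s i) (discontinuities ρ)}

theorem lebesgueOn_real_gridCell (hX : MeasurableSet X) (hs : 0 ≤ s)
    (hi : i ∈ regularCells ρ s) : (lebesgueOn X).real (gridCell X s i) = s := by
  rw [gridCell, lebesgueOn_real_preimage hX, inter_eq_right.2 hi.1, add_smul, one_smul,
    Real.volume_real_Ico_of_le (by linarith), add_sub_cancel_left]

theorem exists_mem_regularCells (hX : X.OrdConnected) (hXb : Bornology.IsBounded X) (hs : 0 < s)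
    (hx : (x : ℝ) ∉ Metric.cthickening s (breakPoints ρ)) :
    ∃ i ∈ regularCells ρ s, x ∈ gridCell X s i := by
  obtain ⟨i, hi⟩ := mem_iUnion.1 ((iUnion_Ico_zsmul hs).ge (mem_univ (x : ℝ)))
  have hfar : ∀ p ∈ breakPoints ρ, s < |(x : ℝ) - p| := fun p hp =>
    not_le.1 fun h => hx (Metric.mem_cthickening_of_dist_le _ p _ _ hp h)
  refine ⟨i, ⟨fun y hy => ?_, disjoint_left.2 fun y hy hyρ => ?_⟩, hi⟩
  · have hxy := abs_lt.1 (abs_sub_lt_of_mem_Ico_zsmul hi hy)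
    have hinf := hfar (sInf X) (by simp [breakPoints])
    have hsup := hfar (sSup X) (by simp [breakPoints])
    rw [abs_of_nonneg (sub_nonneg.2 (csInf_le hXb.bddBelow x.2))] at hinf
    rw [abs_of_nonpos (sub_nonpos.2 (le_csSup hXb.bddAbove x.2))] at hsup
    have hXc : IsConnected X := ⟨⟨x, x.2⟩, hX.isPreconnected⟩
    exact hXc.Ioo_csInf_csSup_subset hXb.bddBelow hXb.bddAbove ⟨by linarith, by linarith⟩
  · exact (hfar y (by simp [breakPoints, hyρ])).not_gt (abs_sub_lt_of_mem_Ico_zsmul hi hy)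

theorem finite_regularCells (hXb : Bornology.IsBounded X) (hs : 0 < s) :
    (regularCells ρ s).Finite := by
  have hfin := Int.tendsto_zmultiplesHom_cofinite hs.ne'
    (Metric.cobounded_eq_cocompact (α := ℝ) ▸ Bornology.isBounded_def.1 hXb)
  refine (mem_cofinite.1 hfin).subset fun i hi h => h (hi.1 ?_)
  simpa [add_mul] using hs

theorem ncard_regularCells_mul_le (hX : MeasurableSet X) (hXb : Bornology.IsBounded X)
    (hs : 0 < s) : (regularCells ρ s).ncard * s ≤ volume.real X := by
  have hfin := finite_regularCells (ρ := ρ) hXb hs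
  have := isFiniteMeasure_lebesgueOn hX hXb
  calc (regularCells ρ s).ncard * s
      = ∑ i ∈ hfin.toFinset, (lebesgueOn X).real (gridCell X s i) := by
        rw [Finset.sum_congr rfl fun i hi =>
          lebesgueOn_real_gridCell hX hs.le (hfin.mem_toFinset.1 hi), Finset.sum_const,
          ncard_eq_toFinset_card _ hfin, nsmul_eq_mul]
    _ ≤ (lebesgueOn X).real univ :=
        sum_measureReal_le_measureReal_univ (fun _ _ => measurableSet_gridCell)
          ((pairwise_disjoint_gridCell X s).set_pairwise _)
    _ = volume.real X := by rw [← preimage_univ, lebesgueOn_real_preimage hX, inter_univ]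

theorem volume_real_cthickening_le {P : Set ℝ} (hP : P.Finite) (hs : 0 ≤ s) :
    volume.real (Metric.cthickening s P) ≤ P.ncard * (2 * s) := by
  have hcover : Metric.cthickening s P = ⋃ p ∈ hP.toFinset, Metric.closedBall p s := by
    simp [hP.isCompact.cthickening_eq_biUnion_closedBall hs]
  calc volume.real (Metric.cthickening s P)
      ≤ ∑ p ∈ hP.toFinset, volume.real (Metric.closedBall p s) :=
        hcover ▸ measureReal_biUnion_finset_le _ _
    _ = P.ncard * (2 * s) := by
        simp [Real.volume_real_closedBall hs, ncard_eq_toFinset_card _ hP]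

theorem lebesgueOn_real_cthickening_le (hX : MeasurableSet X) {P : Set ℝ} (hP : P.Finite)
    (hs : 0 ≤ s) :
    (lebesgueOn X).real (Subtype.val ⁻¹' Metric.cthickening s P) ≤ P.ncard * (2 * s) := by
  rw [lebesgueOn_real_preimage hX]
  exact (measureReal_mono inter_subset_right hP.isBounded.cthickening.measure_lt_top.ne).trans
    (volume_real_cthickening_le hP hs)

theorem IsPiecewiseHolder.exists_oscillation_le (h : IsPiecewiseHolder ρ) :
    ∃ η L δ : ℝ, 0 < η ∧ 0 < δ ∧ ∀ s ≤ δ, ∀ i ∈ regularCells ρ s,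
      ∀ x ∈ gridCell X s i, ∀ y ∈ gridCell X s i, ρ x - ρ y ≤ L * s ^ η := by
  obtain ⟨-, η, L, δ, hη, -, hL, hδ, hρ⟩ := h
  refine ⟨η, L, δ, hη, hδ, fun s hsδ i hi x hx y hy => ?_⟩
  have hxy := dist_lt_of_mem_gridCell hx hy
  calc ρ x - ρ y ≤ |ρ x - ρ y| := le_abs_self _
    _ ≤ L * dist x y ^ η :=
        hρ x y (hxy.trans_le hsδ) (hi.2.mono_left (ordConnected_gridCell.uIcc_subset hx hy))
    _ ≤ L * s ^ η := by gcongr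

end Grid

section Scale

variable {X : Set ℝ} {f : X → X} {μ : Measure X} {ρ : X → ℝ} {s : ℝ} {g n N : ℕ} {i : ℤ}

/-- The points that do not return closer than `s` to themselves up to time `N`. -/
def noReturnSet (f : X → X) (N : ℕ) (s : ℝ) : Set X :=
  {x | ∀ j ∈ Finset.Icc 1 N, s ≤ dist (f^[j] x) x}

theorem antitone_noReturnSet (f : X → X) (s : ℝ) : Antitone fun N => noReturnSet f N s :=
  fun _ _ hN _ hx j hj => hx j (Finset.Icc_subset_Icc_right hN hj)

theorem noReturnSet_inter_gridCell_subset :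
    noReturnSet f N s ∩ gridCell X s i ⊆
      gridCell X s i ∩ f ⁻¹' avoidSet f (gridCell X s i) N := by
  rintro x ⟨hx, hxi⟩
  refine ⟨hxi, fun j hj hj' => ?_⟩
  rw [← Function.iterate_succ_apply] at hj'
  exact (hx (j + 1) (Finset.mem_Icc.2 ⟨by omega, hj⟩)).not_gt (dist_lt_of_mem_gridCell hj' hxi)

theorem noReturnSet_subset (hX : X.OrdConnected) (hXb : Bornology.IsBounded X) (hs : 0 < s) :
    noReturnSet f N s ⊆
      (⋃ i ∈ regularCells ρ s, gridCell X s i ∩ f ⁻¹' avoidSet f (gridCell X s i) N) ∪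
        Subtype.val ⁻¹' Metric.cthickening s (breakPoints ρ) := by
  intro x hx
  by_cases hxρ : (x : ℝ) ∈ Metric.cthickening s (breakPoints ρ)
  · exact Or.inr hxρ
  · obtain ⟨i, hi, hxi⟩ := exists_mem_regularCells hX hXb hs hxρ
    exact Or.inl (mem_biUnion hi (noReturnSet_inter_gridCell_subset ⟨hx, hxi⟩))

theorem sum_shortReturnMass_gridCell_le [IsFiniteMeasure μ] (hf : Measurable f) (G : Finset ℤ)
    (g : ℕ) :
    ∑ i ∈ G, shortReturnMass f μ (gridCell X s i) g
      ≤ ∑ j ∈ Finset.Icc 1 g, μ.real (returnSet f j s) := by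
  simp only [shortReturnMass]
  rw [Finset.sum_comm]
  refine Finset.sum_le_sum fun j _ => ?_
  rw [← measureReal_biUnion_finset
    (fun a _ b _ hab => (pairwise_disjoint_gridCell X s hab).mono inter_subset_left
      inter_subset_left)
    fun i _ => measurableSet_gridCell.inter ((hf.iterate j) measurableSet_gridCell)]
  refine measureReal_mono (iUnion₂_subset fun i _ => ?_)
  rintro x ⟨hx, hx'⟩
  exact (dist_lt_of_mem_gridCell hx hx').le

theorem sum_setIntegral_gridCell_le {ν : Measure X} {ψ : X → ℝ} (hψ : Integrable ψ ν)
    (hψ0 : ∀ x, 0 ≤ ψ x) (G : Finset ℤ) :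
    ∑ i ∈ G, ∫ x in gridCell X s i, ψ x ∂ν ≤ ∫ x, ψ x ∂ν := by
  rw [← integral_biUnion_finset G (fun _ _ => measurableSet_gridCell)
    ((pairwise_disjoint_gridCell X s).set_pairwise _) fun _ _ => hψ.integrableOn]
  exact setIntegral_le_integral hψ (Eventually.of_forall hψ0)

variable [IsFiniteMeasure (lebesgueOn X)] {M : NNReal} {κ e : ℝ}

theorem measureReal_noReturnSet_le_sum (hX : X.OrdConnected) (hXb : Bornology.IsBounded X)
    [IsFiniteMeasure μ] (hM : ∀ x, ρ x ≤ M)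
    (hμ : μ = (lebesgueOn X).withDensity fun x => ENNReal.ofReal (ρ x))
    (hdisc : (discontinuities ρ).Finite) (hs : 0 < s) :
    μ.real (noReturnSet f N s) ≤
      ∑ i ∈ (finite_regularCells (ρ := ρ) hXb hs).toFinset,
        μ.real (gridCell X s i ∩ f ⁻¹' avoidSet f (gridCell X s i) N)
      + M * ((breakPoints ρ).ncard * (2 * s)) := by
  have hnear : μ.real (Subtype.val ⁻¹' Metric.cthickening s (breakPoints ρ)) ≤
      M * ((breakPoints ρ).ncard * (2 * s)) := by
    rw [hμ]
    refine (measureReal_withDensity_ofReal_le hM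
      (Metric.isClosed_cthickening.measurableSet.preimage measurable_subtype_coe)).trans ?_
    gcongr
    exact lebesgueOn_real_cthickening_le hX.measurableSet (((hdisc.image _).insert _).insert _)
      hs.le
  have hcover := measureReal_mono (μ := μ)
    (noReturnSet_subset (f := f) (ρ := ρ) (N := N) hX hXb hs)
  refine hcover.trans ((measureReal_union_le _ _).trans (add_le_add ?_ hnear))
  simpa only [Finite.mem_toFinset] using measureReal_biUnion_finset_le (μ := μ)
    (finite_regularCells (ρ := ρ) hXb hs).toFinset
    fun i => gridCell X s i ∩ f ⁻¹' avoidSet f (gridCell X s i) N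

variable [IsProbabilityMeasure μ]

theorem measureReal_gridCell_inter_preimage_avoidSet_le (hX : MeasurableSet X)
    (hf : MeasurePreserving f μ μ) (hρ : Integrable ρ (lebesgueOn X)) (hρ0 : ∀ x, 0 ≤ ρ x)
    (hM : ∀ x, ρ x ≤ M) (hμ : μ = (lebesgueOn X).withDensity fun x => ENNReal.ofReal (ρ x))
    (hs : 0 ≤ s) (hi : i ∈ regularCells ρ s)
    (hcor : CorrelationBound f μ (gridCell X s i) (g + 1) e)
    (hosc : ∀ x ∈ gridCell X s i, ∀ y ∈ gridCell X s i, ρ x - ρ y ≤ κ)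
    (hne : n * e ≤ 1) (hκ : n * s * κ ≤ 1) :
    μ.real (gridCell X s i ∩ f ⁻¹' avoidSet f (gridCell X s i) (g + n)) ≤
      Real.exp 1 * (Real.exp 1 *
          ∫ x in gridCell X s i, ρ x * Real.exp (-(n * s * ρ x)) ∂lebesgueOn X
        + M * (n * s) * shortReturnMass f μ (gridCell X s i) g) + e := by
  have hA : MeasurableSet (gridCell X s i) := measurableSet_gridCell
  have hvol := lebesgueOn_real_gridCell hX hs hi
  have hdens := setIntegral_mul_exp_neg_le hρ hρ0 hA hosc n.cast_nonneg (hvol.symm ▸ hκ)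
  rw [← measureReal_withDensity_ofReal hρ.aestronglyMeasurable hρ0 hA, ← hμ, hvol] at hdens
  have hmass : μ.real (gridCell X s i) ≤ M * s := by
    have := measureReal_withDensity_ofReal_le (ν := lebesgueOn X) hM hA
    rwa [← hμ, hvol] at this
  refine (measureReal_inter_preimage_avoidSet_le hf hA hcor hne).trans ?_
  have hQ := shortReturnMass_nonneg (f := f) (μ := μ) (A := gridCell X s i) (g := g)
  rw [show (M : ℝ) * (n * s) = M * s * n by ring]
  gcongr

theorem measureReal_noReturnSet_le (hX : X.OrdConnected) (hXb : Bornology.IsBounded X)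
    (hf : MeasurePreserving f μ μ) (hρ : Integrable ρ (lebesgueOn X)) (hρ0 : ∀ x, 0 ≤ ρ x)
    (hM : ∀ x, ρ x ≤ M) (hμ : μ = (lebesgueOn X).withDensity fun x => ENNReal.ofReal (ρ x))
    (hdisc : (discontinuities ρ).Finite) (hs : 0 < s)
    (hcor : ∀ i, CorrelationBound f μ (gridCell X s i) (g + 1) e)
    (hosc : ∀ i ∈ regularCells ρ s,
      ∀ x ∈ gridCell X s i, ∀ y ∈ gridCell X s i, ρ x - ρ y ≤ κ)
    (hne : n * e ≤ 1) (hκ : n * s * κ ≤ 1) :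
    μ.real (noReturnSet f (g + n) s) ≤
      Real.exp 1 * (Real.exp 1 * ∫ x, ρ x * Real.exp (-(n * s * ρ x)) ∂lebesgueOn X
        + M * (n * s) * ∑ j ∈ Finset.Icc 1 g, μ.real (returnSet f j s))
      + volume.real X / s * e + M * ((breakPoints ρ).ncard * (2 * s)) := by
  have hXm : MeasurableSet X := hX.measurableSet
  have hfin := finite_regularCells (ρ := ρ) hXb hs
  set G := hfin.toFinset
  set ψ : X → ℝ := fun x => ρ x * Real.exp (-(n * s * ρ x))
  have hcells : ∀ i ∈ G,
      μ.real (gridCell X s i ∩ f ⁻¹' avoidSet f (gridCell X s i) (g + n)) ≤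
        Real.exp 1 * (Real.exp 1 * ∫ x in gridCell X s i, ψ x ∂lebesgueOn X
          + M * (n * s) * shortReturnMass f μ (gridCell X s i) g) + e := fun i hi =>
    have hi := hfin.mem_toFinset.1 hi
    measureReal_gridCell_inter_preimage_avoidSet_le hXm hf hρ hρ0 hM hμ hs.le hi (hcor i)
      (hosc i hi) hne hκ
  have hcard : (G.card : ℝ) ≤ volume.real X / s := by
    rw [le_div_iff₀ hs, ← ncard_eq_toFinset_card _ hfin]
    exact ncard_regularCells_mul_le hXm hXb hs
  calc μ.real (noReturnSet f (g + n) s)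
      ≤ ∑ i ∈ G, (Real.exp 1 * (Real.exp 1 * ∫ x in gridCell X s i, ψ x ∂lebesgueOn X
          + M * (n * s) * shortReturnMass f μ (gridCell X s i) g) + e)
        + M * ((breakPoints ρ).ncard * (2 * s)) :=
      (measureReal_noReturnSet_le_sum hX hXb hM hμ hdisc hs).trans
        (add_le_add_left (Finset.sum_le_sum hcells) _)
    _ = Real.exp 1 * (Real.exp 1 * ∑ i ∈ G, ∫ x in gridCell X s i, ψ x ∂lebesgueOn X
          + M * (n * s) * ∑ i ∈ G, shortReturnMass f μ (gridCell X s i) g) + G.card * e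
        + M * ((breakPoints ρ).ncard * (2 * s)) := by
      rw [Finset.sum_add_distrib, ← Finset.mul_sum, Finset.sum_add_distrib, ← Finset.mul_sum,
        ← Finset.mul_sum, Finset.sum_const, nsmul_eq_mul]
    _ ≤ _ := by
      gcongr
      · exact sum_setIntegral_gridCell_le (integrable_mul_exp_neg_mul hρ hρ0 (by positivity))
          (fun x => mul_nonneg (hρ0 x) (Real.exp_pos _).le) G
      · exact sum_shortReturnMass_gridCell_le (μ := μ) hf.measurable G g
      · exact (hcor 0).nonneg

end Scale

section DyadicScales

variable {c γ q : ℝ} {k n : ℕ}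

theorem summable_rpow_mul_pow (p : ℝ) (hq : |q| < 1) :
    Summable fun k : ℕ => (k : ℝ) ^ p * q ^ k := by
  refine Summable.of_norm_bounded_eventually_nat
    (summable_pow_mul_geometric_of_norm_lt_one ⌈p⌉₊ (r := |q|) (by simpa using hq)) ?_
  filter_upwards [eventually_ge_atTop 1] with k hk
  rw [norm_mul, norm_pow, Real.norm_of_nonneg (by positivity), Real.norm_eq_abs]
  gcongr
  rw [← Real.rpow_natCast]
  exact Real.rpow_le_rpow_of_exponent_le (by exact_mod_cast hk) (Nat.le_ceil p)

theorem eventually_mul_le_two_pow (K : ℕ) : ∀ᶠ k : ℕ in atTop, K * k ≤ 2 ^ k := by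
  have h := (tendsto_pow_const_div_const_pow_of_one_lt 1 (one_lt_two (α := ℝ))).const_mul (K : ℝ)
  rw [mul_zero] at h
  filter_upwards [h.eventually_le_const one_pos] with k hk
  rw [pow_one, mul_div_assoc', div_le_one (by positivity)] at hk
  exact_mod_cast hk

/-- The radius `c k^γ / 2^k` at the dyadic time `2 ^ k`, which is `c (log n)^γ / n` for
`n = 2 ^ k`, up to a constant factor. -/
noncomputable def dyadicRadius (c γ : ℝ) (k : ℕ) : ℝ := c * (k : ℝ) ^ γ * (1 / 2) ^ k

theorem dyadicRadius_pos (hc : 0 < c) (hk : 0 < k) : 0 < dyadicRadius c γ k := by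
  unfold dyadicRadius
  positivity

theorem two_pow_mul_dyadicRadius (c γ : ℝ) (k : ℕ) :
    2 ^ k * dyadicRadius c γ k = c * (k : ℝ) ^ γ := by
  have : (2 : ℝ) ^ k * (1 / 2) ^ k = 1 := by rw [← mul_pow]; norm_num
  rw [dyadicRadius]
  linear_combination c * (k : ℝ) ^ γ * this

theorem summable_dyadicRadius (c γ : ℝ) : Summable (dyadicRadius c γ) :=
  ((summable_rpow_mul_pow γ (q := 1 / 2) (by norm_num)).mul_left c).congr fun _ =>
    (mul_assoc _ _ _).symm

theorem summable_pow_div_dyadicRadius (c γ : ℝ) :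
    Summable fun k => (1 / 4 : ℝ) ^ k / dyadicRadius c γ k := by
  refine ((summable_rpow_mul_pow (-γ) (q := 1 / 2) (by norm_num)).mul_left
    c⁻¹).congr fun k => ?_
  rw [dyadicRadius, Real.rpow_neg k.cast_nonneg, show (1 / 4 : ℝ) ^ k = (1 / 2) ^ k * (1 / 2) ^ k by
    rw [← mul_pow]; norm_num]
  field_simp

theorem tendsto_rpow_mul_dyadicRadius_rpow (hc : 0 ≤ c) (γ p : ℝ) {η : ℝ} (hη : 0 < η) :
    Tendsto (fun k : ℕ => (k : ℝ) ^ p * dyadicRadius c γ k ^ η) atTop (𝓝 0) := by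
  have hq : |((1 / 2 : ℝ) ^ η)| < 1 := by
    rw [abs_of_nonneg (by positivity)]
    exact Real.rpow_lt_one (by norm_num) (by norm_num) hη
  have h := (summable_rpow_mul_pow (p + γ * η) hq).tendsto_atTop_zero.const_mul (c ^ η)
  rw [mul_zero] at h
  refine h.congr' ?_
  filter_upwards [eventually_gt_atTop 0] with k hk
  have hk' : (0 : ℝ) < k := by exact_mod_cast hk
  rw [dyadicRadius, Real.mul_rpow (by positivity) (by positivity),
    Real.mul_rpow hc (by positivity), Real.rpow_add hk', Real.rpow_mul hk'.le,
    Real.rpow_pow_comm (by norm_num)]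
  ring

theorem eventually_dyadicRadius_le (hc : 0 < c) (γ : ℝ) :
    ∀ᶠ k : ℕ in atTop, dyadicRadius c γ k ≤ ((2 ^ k : ℕ) : ℝ) ^ (-(1 / 2) : ℝ) := by
  have h := (tendsto_rpow_mul_dyadicRadius_rpow hc.le γ γ one_pos).const_mul c
  rw [mul_zero] at h
  filter_upwards [h.eventually_le_const one_pos] with k hk
  rw [Real.rpow_one, ← mul_assoc, ← two_pow_mul_dyadicRadius, mul_assoc] at hk
  have hsq : dyadicRadius c γ k ^ 2 ≤ ((2 ^ k : ℕ) : ℝ)⁻¹ := by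
    rw [← one_div, le_div_iff₀ (by positivity)]
    push_cast
    linarith
  rw [Real.rpow_neg (by positivity), ← Real.sqrt_eq_rpow, ← Real.sqrt_inv]
  exact Real.le_sqrt_of_sq_le hsq

theorem rpow_neg_abs_mul_le {x y : ℝ} (hx : 0 < x) (hxy : x / 2 ≤ y) (hyx : y ≤ 2 * x) (γ : ℝ) :
    2 ^ (-|γ|) * x ^ γ ≤ y ^ γ := by
  have hy : 0 < y := by linarith
  rcases le_total 0 γ with h | h
  · rw [abs_of_nonneg h, Real.rpow_neg (by norm_num), ← Real.inv_rpow (by norm_num),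
      ← Real.mul_rpow (by norm_num) hx.le]
    exact Real.rpow_le_rpow (by positivity) (by linarith) h
  · rw [abs_of_nonpos h, neg_neg, ← Real.mul_rpow (by norm_num) hx.le]
    exact Real.rpow_le_rpow_of_nonpos hy hyx h

theorem dyadicRadius_le_mul_log_rpow_div (hc : 0 ≤ c) (γ : ℝ) (hk : 2 ≤ k)
    (hkn : 2 ^ (k + 1) ≤ n) (hnk : n < 2 ^ (k + 2)) :
    dyadicRadius (c * 2 ^ (-|γ|) / 4) γ k ≤ c * (Real.log n ^ γ / n) := by
  have hk' : (2 : ℝ) ≤ k := by exact_mod_cast hk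
  have hkn' : (2 : ℝ) ^ (k + 1) ≤ n := by exact_mod_cast hkn
  have hnk' : (n : ℝ) ≤ 2 ^ (k + 2) := by exact_mod_cast hnk.le
  have hn : (0 : ℝ) < n := lt_of_lt_of_le (by positivity) hkn'
  have hlog : 2 ^ (-|γ|) * (k : ℝ) ^ γ ≤ Real.log n ^ γ := by
    have hlow := Real.log_le_log (by positivity) hkn'
    have hupp := Real.log_le_log hn hnk'
    rw [Real.log_pow] at hlow hupp
    push_cast at hlow hupp
    have := Real.log_two_gt_d9
    have := Real.log_two_lt_d9
    exact rpow_neg_abs_mul_le (by linarith) (by nlinarith) (by nlinarith) γ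
  have hpow : ((1 : ℝ) / 2) ^ k * n ≤ 4 := by
    rw [one_div, inv_pow, inv_mul_le_iff₀ (by positivity)]
    rw [pow_add] at hnk'
    linarith
  rw [dyadicRadius, mul_div_assoc', le_div_iff₀ hn]
  calc c * 2 ^ (-|γ|) / 4 * (k : ℝ) ^ γ * (1 / 2) ^ k * n
      = c * (2 ^ (-|γ|) * (k : ℝ) ^ γ) / 4 * ((1 / 2) ^ k * n) := by ring
    _ ≤ c * Real.log n ^ γ / 4 * 4 := by gcongr
    _ = c * Real.log n ^ γ := by ring

end DyadicScales

section BorelCantelli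

variable {X : Set ℝ} {f : X → X} {μ : Measure X} {ρ : X → ℝ} {c γ : ℝ}

theorem monotone_returnSet (f : X → X) (j : ℕ) : Monotone (returnSet f j) :=
  fun _ _ hrs _ hx => le_trans hx hrs

theorem HasRareShortReturns.exists_measureReal_returnSet_le [IsFiniteMeasure μ]
    (h : HasRareShortReturns f μ) (hc : 0 < c) (γ : ℝ) (K : ℕ) :
    ∃ q C : ℝ, |q| < 1 ∧ ∀ᶠ k : ℕ in atTop, ∀ j ∈ Finset.Icc 1 (K * k),
      μ.real (returnSet f j (dyadicRadius c γ k)) ≤ C * q ^ k := by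
  obtain ⟨β, C, hβ, -, -, hev⟩ := h (1 / 2) (fun n => (n : ℝ) ^ (-(1 / 2) : ℝ)) (by norm_num)
    ⟨2, by norm_num, by
      filter_upwards [eventually_ge_atTop 1] with n hn
      rw [div_self (by positivity)]
      constructor <;> norm_num⟩
  refine ⟨(1 / 2) ^ (1 / 2 * β), C, ?_, ?_⟩
  · rw [abs_of_nonneg (by positivity)]
    exact Real.rpow_lt_one (by norm_num) (by norm_num) (by positivity)
  filter_upwards [(tendsto_pow_atTop_atTop_of_one_lt (one_lt_two (α := ℕ))).eventually hev,
    eventually_dyadicRadius_le hc γ,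
    tendsto_natCast_atTop_atTop.eventually_ge_atTop (K / Real.log 2 ^ 2)] with k hk hr hKk j hj
  rw [Finset.mem_Icc] at hj
  have hjlog : (j : ℝ) ≤ Real.log (2 ^ k : ℕ) ^ 2 := by
    rw [div_le_iff₀ (by positivity)] at hKk
    calc (j : ℝ) ≤ K * k := by exact_mod_cast hj.2
      _ ≤ k * Real.log 2 ^ 2 * k := by gcongr
      _ = Real.log (2 ^ k : ℕ) ^ 2 := by push_cast; rw [Real.log_pow]; ring
  have hpow : (((2 ^ k : ℕ) : ℝ) ^ (-(1 / 2) : ℝ)) ^ β = ((1 / 2 : ℝ) ^ (1 / 2 * β)) ^ k := by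
    rw [← Real.rpow_mul (by positivity), neg_mul, Real.rpow_neg (by positivity),
      ← Real.inv_rpow (by positivity), Real.rpow_pow_comm (by norm_num)]
    push_cast
    rw [← inv_pow, one_div]
  exact (measureReal_mono (monotone_returnSet f j hr)).trans (hpow ▸ hk j hj.1 hjlog)

theorem HasRareShortReturns.summable_rpow_mul_sum_returnSet [IsFiniteMeasure μ]
    (h : HasRareShortReturns f μ) (hc : 0 < c) (γ p : ℝ) (K : ℕ) :
    Summable fun k : ℕ => (k : ℝ) ^ p *
      ∑ j ∈ Finset.Icc 1 (K * k), μ.real (returnSet f j (dyadicRadius c γ k)) := by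
  obtain ⟨q, C, hq, hret⟩ := h.exists_measureReal_returnSet_le hc γ K
  refine Summable.of_norm_bounded_eventually_nat
    ((summable_rpow_mul_pow (p + 1) hq).mul_left (K * C)) ?_
  filter_upwards [hret, eventually_gt_atTop 0] with k hk hk0
  have hk0' : (k : ℝ) ≠ 0 := by exact_mod_cast hk0.ne'
  have hsum : ∑ j ∈ Finset.Icc 1 (K * k), μ.real (returnSet f j (dyadicRadius c γ k)) ≤
      K * k * (C * q ^ k) := by
    simpa using Finset.sum_le_card_nsmul _ _ _ hk
  rw [Real.norm_of_nonneg (mul_nonneg (by positivity)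
    (Finset.sum_nonneg fun _ _ => measureReal_nonneg)), Real.rpow_add_one hk0']
  calc _ ≤ (k : ℝ) ^ p * (K * k * (C * q ^ k)) := by gcongr
    _ = _ := by ring

theorem eventually_regularCells_oscillation (hρ : IsPiecewiseHolder ρ) (hc : 0 < c) (γ : ℝ) :
    ∀ᶠ k : ℕ in atTop, ∃ κ, 2 ^ k * dyadicRadius c γ k * κ ≤ 1 ∧
      ∀ i ∈ regularCells ρ (dyadicRadius c γ k), ∀ x ∈ gridCell X (dyadicRadius c γ k) i,
        ∀ y ∈ gridCell X (dyadicRadius c γ k) i, ρ x - ρ y ≤ κ := by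
  obtain ⟨η, L, δ, hη, hδ, hosc⟩ := hρ.exists_oscillation_le
  have hκ := (tendsto_rpow_mul_dyadicRadius_rpow hc.le γ γ hη).const_mul (c * L)
  rw [mul_zero] at hκ
  filter_upwards [hκ.eventually_le_const one_pos,
    (summable_dyadicRadius c γ).tendsto_atTop_zero.eventually_le_const hδ] with k hk hkδ
  refine ⟨L * dyadicRadius c γ k ^ η, ?_, hosc _ hkδ⟩
  rw [two_pow_mul_dyadicRadius]
  linarith

theorem summable_measureReal_noReturnSet [IsProbabilityMeasure μ] (hX : X.OrdConnected)
    (hXb : Bornology.IsBounded X) (hsys : IsHyperbolicRecurrent f μ ρ) (hρ : IsPiecewiseHolder ρ)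
    (hc : 0 < c)
    (hsum : Summable fun k : ℕ =>
      ∫ x, ρ x * Real.exp (-(c * (k : ℝ) ^ γ * ρ x)) ∂lebesgueOn X) :
    Summable fun k => μ.real (noReturnSet f (2 ^ (k + 1)) (dyadicRadius c γ k)) := by
  have := isFiniteMeasure_lebesgueOn hX.measurableSet hXb
  have hf := hsys.ergodic.toMeasurePreserving
  obtain ⟨M, hM⟩ := hsys.density_bv.exists_norm_le
  obtain ⟨K, C, hcor⟩ := hsys.exp_decay.exists_correlationBound hf.measurable
    (q := 1 / 4) (by norm_num)
  have hne := (tendsto_pow_atTop_nhds_zero_of_lt_one (r := (1 / 2 : ℝ)) (by norm_num)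
    (by norm_num)).const_mul C
  rw [mul_zero] at hne
  refine Summable.of_norm_bounded_eventually_nat
    (((((hsum.mul_left (Real.exp 1)).add
      ((hsys.rare_short_returns.summable_rpow_mul_sum_returnSet hc γ γ K).mul_left
        (M * c))).mul_left (Real.exp 1)).add
      ((summable_pow_div_dyadicRadius c γ).mul_left (volume.real X * C))).add
      ((summable_dyadicRadius c γ).mul_left ((M : ℝ) * (breakPoints ρ).ncard * 2))) ?_
  filter_upwards [eventually_gt_atTop 0, eventually_mul_le_two_pow K,
    hne.eventually_le_const one_pos, eventually_regularCells_oscillation hρ hc γ]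
    with k hk hKk hCk ⟨κ, hκ, hosc⟩
  have hbound := measureReal_noReturnSet_le (n := 2 ^ k) hX hXb hf
    (hsys.density_bv.integrable) hsys.density_nonneg
    (fun x => (Real.le_norm_self _).trans (hM x)) hsys.density_eq hρ.1
    (dyadicRadius_pos (γ := γ) hc hk) (fun i => hcor k _ ordConnected_gridCell) hosc
    (by
      push_cast
      rw [mul_left_comm, ← mul_pow]
      norm_num at hCk ⊢
      exact hCk)
    (by exact_mod_cast hκ)
  push_cast at hbound
  rw [two_pow_mul_dyadicRadius] at hbound
  rw [Real.norm_of_nonneg measureReal_nonneg]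
  refine (measureReal_mono (antitone_noReturnSet f _ ?_)).trans (hbound.trans_eq (by ring))
  rw [pow_succ]
  lia

theorem eventually_minReturnDist_lt {x : X} (hc : 0 ≤ c)
    (hx : ∀ᶠ k in atTop,
      x ∉ noReturnSet f (2 ^ (k + 1)) (dyadicRadius (c * 2 ^ (-|γ|) / 4) γ k)) :
    ∀ᶠ n : ℕ in atTop, minReturnDist f n x < c * (Real.log n ^ γ / n) := by
  obtain ⟨k₀, hk₀⟩ := eventually_atTop.1 hx
  filter_upwards [eventually_ge_atTop (2 ^ (max k₀ 2 + 1))] with n hn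
  have hn0 : n ≠ 0 := (lt_of_lt_of_le (by positivity) hn).ne'
  have hlog : max k₀ 2 + 1 ≤ Nat.log 2 n := (Nat.le_log_iff_pow_le one_lt_two hn0).2 hn
  obtain ⟨k, hk⟩ : ∃ k, Nat.log 2 n = k + 1 := ⟨Nat.log 2 n - 1, by lia⟩
  have hkn : 2 ^ (k + 1) ≤ n := hk ▸ Nat.pow_log_le_self 2 hn0
  have hnk : n < 2 ^ (k + 2) := by
    have := Nat.lt_pow_succ_log_self one_lt_two n
    rwa [hk] at this
  obtain ⟨j, hj, hjd⟩ : ∃ j ∈ Finset.Icc 1 (2 ^ (k + 1)),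
      dist (f^[j] x) x < dyadicRadius (c * 2 ^ (-|γ|) / 4) γ k := by
    simpa only [noReturnSet, mem_ofPred_eq, not_forall, not_le, exists_prop] using
      hk₀ k (by lia)
  rw [Finset.mem_Icc] at hj
  calc minReturnDist f n x ≤ dist (f^[j] x) x :=
        csInf_le ⟨0, by rintro _ ⟨i, -, rfl⟩; exact dist_nonneg⟩
          ⟨j, ⟨hj.1, hj.2.trans hkn⟩, rfl⟩
    _ < dyadicRadius (c * 2 ^ (-|γ|) / 4) γ k := hjd
    _ ≤ c * (Real.log n ^ γ / n) := dyadicRadius_le_mul_log_rpow_div hc γ (by lia) hkn hnk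

end BorelCantelli

theorem mainTheorem7_general (X : Set ℝ) (hX : X.OrdConnected) (hXb : Bornology.IsBounded X)
    (f : X → X) (μ : Measure X) [IsProbabilityMeasure μ] (ρ : X → ℝ)
    (hsys : IsHyperbolicRecurrent f μ ρ) (hρ : IsPiecewiseHolder ρ) (γ : ℝ)
    (hsum : ∀ ε : ℝ, 0 < ε →
      Summable (fun k : ℕ =>
        ∫ x : X, ρ x * Real.exp (-(ε * ((k + 1 : ℕ) : ℝ) ^ γ * ρ x)) ∂lebesgueOn X))
    (c : ℝ) (hc : 0 < c) (r : ℕ → ℝ) (hr : ∀ᶠ n : ℕ in atTop, c * (Real.log n ^ γ / n) ≤ r n) :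
    μ {x : X | ∀ᶠ n : ℕ in atTop, minReturnDist f n x < r n} = 1 := by
  have hε : 0 < c * 2 ^ (-|γ|) / 4 := by positivity
  have hnoReturn : ∑' k, μ (noReturnSet f (2 ^ (k + 1))
      (dyadicRadius (c * 2 ^ (-|γ|) / 4) γ k)) ≠ ∞ := by
    simpa only [ofReal_measureReal (h := measure_ne_top _ _)] using
      (summable_measureReal_noReturnSet hX hXb hsys hρ hε
        ((summable_nat_add_iff 1).1 (hsum _ hε))).tsum_ofReal_ne_top
  have hae : ∀ᵐ x ∂μ, ∀ᶠ n : ℕ in atTop, minReturnDist f n x < r n := by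
    filter_upwards [ae_eventually_notMem hnoReturn] with x hx
    filter_upwards [eventually_minReturnDist_lt hc.le hx, hr] with n hn hrn
    exact hn.trans_le hrn
  rw [measure_congr (eventuallyEq_univ.2 hae), measure_univ]

theorem mainTheorem7 (X : Set ℝ) (hX : X.OrdConnected) (hXb : Bornology.IsBounded X)
    (f : X → X) (μ : Measure X) [IsProbabilityMeasure μ] (ρ : X → ℝ)
    (hsys : IsHyperbolicRecurrent f μ ρ)
    (hρ : IsPiecewiseHolder ρ)
    (γ γ₀ : ℝ) (hγ : γ₀ < γ)
    (hsum : ∀ ε : ℝ, 0 < ε →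
      Summable (fun k : ℕ =>
        ∫ x : X, ρ x * Real.exp (-(ε * ((k + 1 : ℕ) : ℝ) ^ γ₀ * ρ x)) ∂lebesgueOn X))
    (r : ℕ → ℝ) (hr : ∀ᶠ n : ℕ in atTop, Real.log n ^ γ / (2 * n) < r n) :
    μ {x : X | ∀ᶠ n : ℕ in atTop, minReturnDist f n x < r n} = 1 := by
  have := isFiniteMeasure_lebesgueOn hX.measurableSet hXb
  refine mainTheorem7_general X hX hXb f μ ρ hsys hρ γ
    (fun ε hε => summable_integral_mul_exp_neg_rpow_mono hsys.density_bv.integrable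
      hsys.density_nonneg hε.le hγ.le (hsum ε hε)) (1 / 2) (by norm_num) r ?_
  filter_upwards [hr] with n hn
  exact (le_of_eq (by ring)).trans hn.le
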